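/- An arithmetic circuit over a commutative ring $R$ is a finite acyclic directed graph with exactly one vertex of out-degree $0$ (the output), in which the vertices of in-degree $0$ (the inputs) are labelled by constants of $R$ or by variables and all other vertices by $+$ or $\times$. Its vertices are called gates, its size is the number of gates, the fan-in of a gate is its in-degree, and it computes the polynomial computed by its output. A $\sum\prod^{[\alpha]}\sum\prod^{[\beta]}$ circuit is a circuit whose gates are layered into levels $0,\dots,4$, with arrows only from one level to the next, inputs at level $0$, $\times$-gates at levels $1$ and $3$, $+$-gates at levels $2$ and $4$, the output at level $4$, fan-in at most $\alpha$ at level $3$ and at most $\beta$ at level $1$. Let $\mathrm{Perm}_n=\sum_{\pi\in\mathfrak S_n}\prod_{i=1}^n x_{\pi(i),i}$ be the permanent of the $n\times n$ matrix of variables. **Theorem.** If $\mathrm{Perm}_n$ is computed by a circuit of size polynomial in $n$, then it is also computed by a $\sum\prod^{[O(\sqrt n)]}\sum\prod^{[O(\sqrt n)]}$ circuit of size $2^{O(\sqrt n\log n)}$. Precisely: for every polynomial $p\in\mathbb N[t]$ there is a constant $K>0$ such that for every commutative ring $R$ and every $n\ge 2$, if $\mathrm{Perm}_n$ is computed by a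 circuit over $R$ of size at most $p(n)$, then it is computed by a $\sum\prod^{[K\sqrt n]}\sum\prod^{[K\sqrt n]}$ circuit over $R$ of size at most $2^{K\sqrt n\log n}$. -/

import Mathlib

/-- Labels of the gates of an arithmetic circuit: an input is labelled by a constant of `R` or by
a variable of `σ`, a computation gate is labelled by `+` or `×`. -/
inductive GateLabel (R σ : Type*) where
  | const (c : R)
  | var (i : σ)
  | add
  | mul

/-- The labels that inputs carry. -/
def GateLabel.IsInput {R σ : Type*} : GateLabel R σ → Prop
  | .const _ => True
  | .var _ => True
  | .add => False
  | .mul => False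

/-- An arithmetic circuit over `R` with variables in `σ`: a finite acyclic directed graph with
labelled vertices (gates), any in-degree (fan-in) and any out-degree, in which exactly the vertices
of in-degree `0` are inputs, and exactly one vertex, the output, has out-degree `0`. -/
structure ArithCircuit (R σ : Type*) where
  /-- the gates -/
  Gate : Type
  [fintypeGate : Fintype Gate]
  label : Gate → GateLabel R σ
  /-- `args v` is the set of the gates `u` with an arrow from `u` to `v`. -/
  args : Gate → Finset Gate
  /-- There is no directed cycle (for a finite graph this is well-foundedness of the arrows). -/
  acyclic : WellFounded (fun u v : Gate => u ∈ args v)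
  args_eq_empty_iff : ∀ v, args v = ∅ ↔ (label v).IsInput
  /-- the output -/
  out : Gate
  out_iff : ∀ v, (∀ w, v ∉ args w) ↔ v = out

attribute [instance] ArithCircuit.fintypeGate

namespace ArithCircuit

variable {R σ : Type*}

/-- The size of a circuit is its number of gates. -/
def size (C : ArithCircuit R σ) : ℕ := Fintype.card C.Gate

/-- The fan-in of a gate is its in-degree. -/
def fanIn (C : ArithCircuit R σ) (v : C.Gate) : ℕ := (C.args v).card

/-- The polynomial computed by a gate, by recursion along the arrows. -/
noncomputable def gatePoly [CommRing R] (C : ArithCircuit R σ) : C.Gate → MvPolynomial σ R :=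
  C.acyclic.fix fun v ih =>
    match C.label v with
    | .const c => MvPolynomial.C c
    | .var i => MvPolynomial.X i
    | .add => ∑ u ∈ (C.args v).attach, ih u.1 u.2
    | .mul => ∏ u ∈ (C.args v).attach, ih u.1 u.2

theorem gatePoly_eq [CommRing R] (C : ArithCircuit R σ) (v : C.Gate) :
    C.gatePoly v =
      match C.label v with
      | .const c => MvPolynomial.C c
      | .var i => MvPolynomial.X i
      | .add => ∑ u ∈ C.args v, C.gatePoly u
      | .mul => ∏ u ∈ C.args v, C.gatePoly u := by
  rw [gatePoly, WellFounded.fix_eq]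
  cases C.label v with
  | const c => rfl
  | var i => rfl
  | add => exact Finset.sum_attach (C.args v) (fun u => C.gatePoly u)
  | mul => exact Finset.prod_attach (C.args v) (fun u => C.gatePoly u)

/-- A circuit computes the polynomial computed by its output. -/
def Computes [CommRing R] (C : ArithCircuit R σ) (f : MvPolynomial σ R) : Prop :=
  C.gatePoly C.out = f

/-- `C` is a `ΣΠ^[α]ΣΠ^[β]` circuit: its gates are layered into five levels, every arrow leads
from a level to the next one, the gates of level `0` are the inputs, those of levels `1` and `3`
are `×`-gates, those of levels `2` and `4` are `+`-gates, the output is of level `4`, and the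
fan-in is at most `α` at level `3` and at most `β` at level `1`. -/
def IsSigmaPiSigmaPi (C : ArithCircuit R σ) (α β : ℝ) : Prop :=
  ∃ level : C.Gate → ℕ,
    level C.out = 4 ∧
    (∀ v, ∀ u ∈ C.args v, level v = level u + 1) ∧
    (∀ v, (C.label v).IsInput ↔ level v = 0) ∧
    (∀ v, C.label v = GateLabel.mul ↔ level v = 1 ∨ level v = 3) ∧
    (∀ v, C.label v = GateLabel.add ↔ level v = 2 ∨ level v = 4) ∧
    (∀ v, level v = 3 → (C.fanIn v : ℝ) ≤ α) ∧
    (∀ v, level v = 1 → (C.fanIn v : ℝ) ≤ β)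

end ArithCircuit

/-- The permanent of the `n × n` matrix whose entries are `n ^ 2` distinct variables. -/
noncomputable def genericPermanent (R : Type*) [CommRing R] (n : ℕ) :
    MvPolynomial (Fin n × Fin n) R :=
  (Matrix.mvPolynomialX (Fin n) (Fin n) R).permanent

/-! Depth reduction by gate quotients. Take the positive-degree homogeneous components, up to degree
`n`, of all gate polynomials and of the partial products at the gates. Each component of degree at
least 2 is a linear combination of products of two components of smaller positive degree
(`isGenerated_polys`). Writing the heavier factor as the unknown gives equations `f = T f` in
degrees at least 2, with `T` nilpotent since it lowers degree; the entries of `Q = (1 - T)⁻¹` play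
the role of gate quotients.

Stopping the recursion where the degree first drops to `m` or below (`eq_sum_frontier`) writes a
member, or a quotient, as a sum over triples of indices of a scalar times three polynomials of the
same two kinds. With `m` in the middle the degrees drop fast enough that about `4 n / t` expansions
leave only factors of degree at most `t` (`expands_aux`). Each expansion multiplies the number of
summands by the cube of the number of members and adds three factors.

For `t = ⌊√n⌋` this gives `2^{O(√n log n)}` products of `O(√n)` polynomials of degree at most `t` in
`n²` variables. Writing each such polynomial as a combination of words of length `t` gives the
depth-four circuit. Of the permanent only homogeneity of degree `n` is used. -/

open MvPolynomial

/-! ### Homogeneous components of products -/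

section Homogeneous

variable {R σ : Type*} [CommRing R]

theorem MvPolynomial.homogeneousComponent_mul (n : ℕ) (φ ψ : MvPolynomial σ R) :
    homogeneousComponent n (φ * ψ) = ∑ x ∈ Finset.HasAntidiagonal.antidiagonal n,
      homogeneousComponent x.1 φ * homogeneousComponent x.2 ψ := by
  classical
  ext d
  simp only [coeff_homogeneousComponent, coeff_sum, coeff_mul]
  rw [Finset.sum_comm]
  have key : ∀ x ∈ Finset.HasAntidiagonal.antidiagonal d, ∑ y ∈ Finset.HasAntidiagonal.antidiagonal n,
      (if x.1.degree = y.1 then coeff x.1 φ else 0) *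
        (if x.2.degree = y.2 then coeff x.2 ψ else 0) =
      if d.degree = n then coeff x.1 φ * coeff x.2 ψ else 0 := by
    rintro ⟨x, y⟩ hx
    obtain rfl : x + y = d := Finset.HasAntidiagonal.mem_antidiagonal.1 hx
    rw [map_add]
    split_ifs with h
    · rw [Finset.sum_eq_single (x.degree, y.degree)]
      · simp
      · rintro ⟨a, b⟩ - hab
        by_cases h1 : x.degree = a
        · have h2 : y.degree ≠ b := by
            rintro rfl
            exact hab (by rw [h1])
          simp [h2]
        · simp [h1]
      · intro h'
        exact absurd (Finset.HasAntidiagonal.mem_antidiagonal.2 h) h'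
    · refine Finset.sum_eq_zero fun z hz => ?_
      have hz' := Finset.HasAntidiagonal.mem_antidiagonal.1 hz
      by_cases h1 : x.degree = z.1
      · have h2 : y.degree ≠ z.2 := fun h2 => h (by rw [h1, h2, hz'])
        simp [h2]
      · simp [h1]
  rw [Finset.sum_congr rfl key]
  split_ifs <;> simp

theorem MvPolynomial.totalDegree_homogeneousComponent_le (n : ℕ) (φ : MvPolynomial σ R) :
    (homogeneousComponent n φ).totalDegree ≤ n :=
  (homogeneousComponent_isHomogeneous n φ).totalDegree_le

end Homogeneous

/-! ### Calculus of sums of products of low-degree polynomials -/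

section SumOfProducts

variable {R σ : Type*} [CommRing R]

/-- `p` is a sum of at most `M` products of at most `k` polynomials of total degree at most `t`. -/
def IsSumOfProducts (t M k : ℕ) (p : MvPolynomial σ R) : Prop :=
  ∃ L : List (List (MvPolynomial σ R)), L.length ≤ M ∧
    (∀ l ∈ L, l.length ≤ k ∧ ∀ q ∈ l, q.totalDegree ≤ t) ∧ (L.map List.prod).sum = p

namespace IsSumOfProducts

variable {t M M' k k' : ℕ} {p q : MvPolynomial σ R}

theorem mono (h : IsSumOfProducts t M k p) (hM : M ≤ M') (hk : k ≤ k') :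
    IsSumOfProducts t M' k' p := by
  obtain ⟨L, h1, h2, h3⟩ := h
  exact ⟨L, h1.trans hM, fun l hl => ⟨(h2 l hl).1.trans hk, (h2 l hl).2⟩, h3⟩

theorem zero : IsSumOfProducts t M k (0 : MvPolynomial σ R) := ⟨[], by simp⟩

theorem of_totalDegree_le (h : p.totalDegree ≤ t) : IsSumOfProducts t 1 1 p :=
  ⟨[[p]], by simp [h]⟩

theorem add (hp : IsSumOfProducts t M k p) (hq : IsSumOfProducts t M' k q) :
    IsSumOfProducts t (M + M') k (p + q) := by
  obtain ⟨L, h1, h2, rfl⟩ := hp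
  obtain ⟨L', h1', h2', rfl⟩ := hq
  refine ⟨L ++ L', by simp; omega, fun l hl => ?_, by simp⟩
  rcases List.mem_append.1 hl with h | h
  exacts [h2 l h, h2' l h]

theorem sum {ι : Type*} (s : Finset ι) (g : ι → MvPolynomial σ R)
    (h : ∀ i ∈ s, IsSumOfProducts t M k (g i)) :
    IsSumOfProducts t (s.card * M) k (∑ i ∈ s, g i) := by
  classical
  induction s using Finset.induction_on with
  | empty => simpa using zero
  | insert a s ha ih =>
    rw [Finset.sum_insert ha, Finset.card_insert_of_notMem ha, add_mul, one_mul,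
      add_comm (g a)]
    exact (ih fun i hi => h i (Finset.mem_insert_of_mem hi)).add (h a (Finset.mem_insert_self a s))

theorem list_prod_mul (l : List (MvPolynomial σ R)) (L : List (List (MvPolynomial σ R))) :
    ((L.map (l ++ ·)).map List.prod).sum = l.prod * (L.map List.prod).sum := by
  induction L with
  | nil => simp
  | cons a L ih => simp [mul_add, ← ih]

theorem mul (hp : IsSumOfProducts t M k p) (hq : IsSumOfProducts t M' k' q) :
    IsSumOfProducts t (M * M') (k + k') (p * q) := by
  obtain ⟨L, h1, h2, rfl⟩ := hp
  obtain ⟨L', h1', h2', rfl⟩ := hq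
  refine ⟨L.flatMap fun l => L'.map (l ++ ·), ?_, ?_, ?_⟩
  · simp only [List.length_flatMap, List.length_map, List.map_const', List.sum_replicate,
      smul_eq_mul]
    exact Nat.mul_le_mul h1 h1'
  · intro l hl
    obtain ⟨l1, hl1, hl⟩ := List.mem_flatMap.1 hl
    obtain ⟨l2, hl2, rfl⟩ := List.mem_map.1 hl
    refine ⟨?_, fun q hq => ?_⟩
    · rw [List.length_append]
      exact Nat.add_le_add (h2 l1 hl1).1 (h2' l2 hl2).1
    · rcases List.mem_append.1 hq with h | h
      exacts [(h2 l1 hl1).2 q h, (h2' l2 hl2).2 q h]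
  · clear h1 h2
    induction L with
    | nil => simp
    | cons a L ih =>
      rw [List.flatMap_cons, List.map_append, List.sum_append, ih, list_prod_mul, List.map_cons,
        List.sum_cons, add_mul]

end IsSumOfProducts

end SumOfProducts

/-! ### Product systems, gate quotients and the frontier identity -/

/-- A finite family of polynomials `f i` of degree at most `d i`, in which every member of degree
at least `2` is a linear combination of products of two members of smaller degree. -/
structure ProductSystem (R σ I : Type*) [CommRing R] [Fintype I] where
  f : I → MvPolynomial σ R
  d : I → ℕ
  coef : I → I → I → R
  d_pos : ∀ i, 1 ≤ d i
  totalDegree_le : ∀ i, (f i).totalDegree ≤ d i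
  coef_ne_zero : ∀ i a b, coef i a b ≠ 0 → d a + d b = d i ∧ d b ≤ d a
  f_eq : ∀ i, 2 ≤ d i → f i = ∑ a, ∑ b, C (coef i a b) * f b * f a

namespace ProductSystem

variable {R σ I : Type*} [CommRing R] [Fintype I] (P : ProductSystem R σ I)

/-- Commutativity lets the heavier factor always come first. This ordering later bounds the lighter
factor by `m` at a frontier. -/
theorem exists_of_mem_span (f : I → MvPolynomial σ R) (d : I → ℕ) (d_pos : ∀ i, 1 ≤ d i)
    (hf : ∀ i, (f i).totalDegree ≤ d i)
    (hspan : ∀ i, 2 ≤ d i →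
      f i ∈ Submodule.span R {q | ∃ a b, d a + d b = d i ∧ q = f a * f b}) :
    ∃ P : ProductSystem R σ I, P.f = f ∧ P.d = d := by
  classical
  have H : ∀ i, ∃ c : I × I → R, 2 ≤ d i →
      ∑ x, c x • (if d x.1 + d x.2 = d i ∧ d x.2 ≤ d x.1 then f x.2 * f x.1 else 0) = f i := by
    intro i
    by_cases hi : 2 ≤ d i
    · have : f i ∈ Submodule.span R (Set.range fun x : I × I =>
          if d x.1 + d x.2 = d i ∧ d x.2 ≤ d x.1 then f x.2 * f x.1 else 0) := by
        refine Submodule.span_le.2 ?_ (hspan i hi)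
        rintro _ ⟨a, b, hab, rfl⟩
        rcases le_total (d b) (d a) with h | h
        · exact Submodule.subset_span ⟨(a, b), by simp [hab, h, mul_comm]⟩
        · exact Submodule.subset_span ⟨(b, a), by simp [add_comm (d b), hab, h]⟩
      obtain ⟨c, hc⟩ := (Submodule.mem_span_range_iff_exists_fun R).1 this
      exact ⟨c, fun _ => hc⟩
    · exact ⟨0, fun h => absurd h hi⟩
  choose c hc using H
  refine ⟨⟨f, d, fun i a b => if d a + d b = d i ∧ d b ≤ d a then c i (a, b) else 0, d_pos, hf,
    fun i a b h => ?_, fun i hi => ?_⟩, rfl, rfl⟩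
  · by_contra h'
    simp [h'] at h
  · conv_lhs => rw [← hc i hi, Fintype.sum_prod_type]
    refine Finset.sum_congr rfl fun a _ => Finset.sum_congr rfl fun b _ => ?_
    dsimp only
    split_ifs <;> simp [smul_eq_C_mul, mul_assoc]

/-- The matrix of the equations `f i = ∑ a, T i a * f a`. -/
noncomputable def T : Matrix I I (MvPolynomial σ R) :=
  fun i a => ∑ b, C (P.coef i a b) * P.f b

/-- The entry `A i j` has total degree at most `d i - d j`, and vanishes if this is negative. -/
def DegreeBounded (A : Matrix I I (MvPolynomial σ R)) : Prop :=
  ∀ i j, A i j ≠ 0 → (A i j).totalDegree + P.d j ≤ P.d i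

/-- The lighter factor has positive degree, so every nonzero entry of `T` strictly lowers the
degree; nilpotence follows. -/
theorem T_ne_zero {i a : I} (h : P.T i a ≠ 0) : P.d a < P.d i := by
  obtain ⟨b, -, hb⟩ := Finset.exists_ne_zero_of_sum_ne_zero h
  have hc : P.coef i a b ≠ 0 := by
    rintro h0
    simp [h0] at hb
  have := (P.coef_ne_zero i a b hc).1
  have := P.d_pos b
  omega

theorem degreeBounded_T : P.DegreeBounded P.T := by
  intro i a h
  have h1 := P.T_ne_zero h
  have : (P.T i a).totalDegree ≤ P.d i - P.d a := by
    refine totalDegree_finsetSum_le fun b _ => ?_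
    by_cases hc : P.coef i a b = 0
    · simp [hc]
    · have := (P.coef_ne_zero i a b hc).1
      have h2 := totalDegree_mul (C (P.coef i a b)) (P.f b)
      have h3 := P.totalDegree_le b
      rw [totalDegree_C] at h2
      omega
  omega

theorem DegreeBounded.sum {P : ProductSystem R σ I} {ι : Type*} (s : Finset ι)
    {A : ι → Matrix I I (MvPolynomial σ R)} (hA : ∀ x ∈ s, P.DegreeBounded (A x)) :
    P.DegreeBounded (∑ x ∈ s, A x) := by
  intro i j h
  rw [Matrix.sum_apply] at h ⊢
  obtain ⟨x, hx, hx0⟩ := Finset.exists_ne_zero_of_sum_ne_zero h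
  have h1 := hA x hx i j hx0
  have : (∑ x ∈ s, A x i j).totalDegree ≤ P.d i - P.d j := by
    refine totalDegree_finsetSum_le fun y hy => ?_
    by_cases hy0 : A y i j = 0
    · simp [hy0]
    · have := hA y hy i j hy0
      omega
  omega

theorem DegreeBounded.mul {P : ProductSystem R σ I} {A B : Matrix I I (MvPolynomial σ R)}
    (hA : P.DegreeBounded A) (hB : P.DegreeBounded B) : P.DegreeBounded (A * B) := by
  intro i j h
  rw [Matrix.mul_apply] at h ⊢
  have key : ∀ a, A i a * B a j ≠ 0 → (A i a * B a j).totalDegree + P.d j ≤ P.d i := by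
    intro a ha
    have h1 := hA i a (left_ne_zero_of_mul ha)
    have h2 := hB a j (right_ne_zero_of_mul ha)
    have h3 := totalDegree_mul (A i a) (B a j)
    omega
  obtain ⟨x, -, hx0⟩ := Finset.exists_ne_zero_of_sum_ne_zero h
  have h1 := key x hx0
  have : (∑ x, A i x * B x j).totalDegree ≤ P.d i - P.d j := by
    refine totalDegree_finsetSum_le fun y _ => ?_
    by_cases hy0 : A i y * B y j = 0
    · simp [hy0]
    · have := key y hy0
      omega
  omega

variable [DecidableEq I]

theorem degreeBounded_T_pow (k : ℕ) : P.DegreeBounded (P.T ^ k) := by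
  induction k with
  | zero =>
    intro i j h
    obtain rfl : i = j := by
      by_contra hij
      simp [hij] at h
    simp
  | succ k ih =>
    rw [pow_succ]
    exact ih.mul P.degreeBounded_T

theorem T_pow_ne_zero (k : ℕ) (i j : I) (h : (P.T ^ k) i j ≠ 0) : P.d j + k ≤ P.d i := by
  induction k generalizing j with
  | zero =>
    obtain rfl : i = j := by
      by_contra hij
      simp [hij] at h
    simp
  | succ k ih =>
    rw [pow_succ, Matrix.mul_apply] at h
    obtain ⟨a, -, ha⟩ := Finset.exists_ne_zero_of_sum_ne_zero h
    have h1 := ih a (left_ne_zero_of_mul ha)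
    have h2 := P.T_ne_zero (right_ne_zero_of_mul ha)
    omega

/-- An exponent at which the powers of `T` vanish. -/
def height : ℕ := Finset.univ.sup P.d

theorem T_pow_height : P.T ^ P.height = 0 := by
  refine Matrix.ext fun i j => ?_
  by_contra h
  have h1 := P.T_pow_ne_zero _ i j h
  have h2 : P.d i ≤ P.height := Finset.le_sup (Finset.mem_univ i)
  have := P.d_pos j
  omega

/-- The inverse of `1 - T`; its entries are the gate quotients. -/
noncomputable def Q : Matrix I I (MvPolynomial σ R) := ∑ k ∈ Finset.range P.height, P.T ^ k

theorem degreeBounded_Q : P.DegreeBounded P.Q :=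
  DegreeBounded.sum _ fun k _ => P.degreeBounded_T_pow k

theorem Q_eq : P.Q = P.T * P.Q + 1 := by
  have h := geom_sum_succ (x := P.T) (n := P.height)
  rw [Finset.sum_range_succ, T_pow_height, add_zero] at h
  exact h

theorem Q_mul_one_sub : P.Q * (1 - P.T) = 1 := by
  rw [Q, geom_sum_mul_neg, T_pow_height, sub_zero]

/-- A solution of `x = T x` above degree `m` is determined by its values up to degree `m`. -/
theorem eq_sum_frontier (m : ℕ) (x : I → MvPolynomial σ R)
    (hx : ∀ i, m < P.d i → x i = ∑ a, P.T i a * x a) (i : I) (hi : m < P.d i) :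
    x i = ∑ z : I × I × I, if m < P.d z.1 ∧ P.d z.2.1 ≤ m then
      P.Q i z.1 * (C (P.coef z.1 z.2.1 z.2.2) * P.f z.2.2) * x z.2.1 else 0 := by
  set x' : I → MvPolynomial σ R := fun i => if m < P.d i then x i else 0 with hx'
  set y : I → MvPolynomial σ R := fun i =>
    if m < P.d i then ∑ a, (if P.d a ≤ m then P.T i a * x a else 0) else 0 with hy
  -- Truncating `x` to degrees above `m` breaks the equation only by the terms crossing the
  -- threshold, which form `y`. Rows of degree at most `m` stay zero because `T` lowers degree.
  -- Applying `Q` then recovers `x`.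
  have h1 : (1 - P.T).mulVec x' = y := by
    rw [Matrix.sub_mulVec, Matrix.one_mulVec]
    funext j
    rw [Pi.sub_apply, sub_eq_iff_eq_add, Matrix.mulVec, dotProduct]
    by_cases hj : m < P.d j
    · simp only [hx', hy, hj, if_true]
      rw [hx j hj, ← Finset.sum_add_distrib]
      refine Finset.sum_congr rfl fun a _ => ?_
      by_cases ha : P.d a ≤ m
      · simp [ha, not_lt.2 ha]
      · simp [ha, not_le.1 ha]
    · simp only [hx', hy, hj, if_false, zero_add]
      symm
      refine Finset.sum_eq_zero fun a _ => ?_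
      by_cases hT : P.T j a = 0
      · simp [hT]
      · have := P.T_ne_zero hT
        rw [if_neg (by omega), mul_zero]
  have h2 : x' = P.Q.mulVec y := by
    rw [← h1, Matrix.mulVec_mulVec, Q_mul_one_sub, Matrix.one_mulVec]
  have h3 := congrFun h2 i
  simp only [hx', hi, if_true] at h3
  rw [h3, Matrix.mulVec, dotProduct, Fintype.sum_prod_type]
  refine Finset.sum_congr rfl fun a _ => ?_
  rw [Fintype.sum_prod_type]
  by_cases ha : m < P.d a
  · simp only [hy, ha, if_true, true_and, Finset.mul_sum]
    refine Finset.sum_congr rfl fun a' _ => ?_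
    split_ifs with ha'
    · rw [T, Finset.sum_mul, Finset.mul_sum]
      exact Finset.sum_congr rfl fun b _ => by ring
    · simp
  · simp [hy, ha]

end ProductSystem

/-! ### Counting the expansions -/

namespace ProductSystem

/-- The number of expansions granted to a member of degree `D`. -/
def memberCost (t D : ℕ) : ℕ := if D ≤ t then 0 else 4 * D / t - 2

/-- The number of expansions granted to a gate quotient of degree `D`. -/
def quotientCost (t D : ℕ) : ℕ := if D ≤ t then 0 else 4 * D / t - 1

/-- Clearing the denominator `t` leaves linear inequalities with `t * memberCost t D` as an atom.
The truncated subtraction is harmless because `t < D` makes the quotient at least 2. -/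
theorem memberCost_spec {t : ℕ} (D : ℕ) :
    (D ≤ t ∧ t * memberCost t D = 0) ∨ (t < D ∧ t * memberCost t D + 2 * t ≤ 4 * D) := by
  by_cases h : D ≤ t
  · exact Or.inl ⟨h, by rw [memberCost, if_pos h, mul_zero]⟩
  · refine Or.inr ⟨by omega, ?_⟩
    rw [memberCost, if_neg h]
    have h1 := Nat.mul_div_le (4 * D) t
    rcases Nat.eq_zero_or_pos t with rfl | ht
    · simp
    · have h2 : 2 ≤ 4 * D / t := (Nat.le_div_iff_mul_le ht).2 (by omega)
      obtain ⟨k, hk⟩ := Nat.exists_eq_add_of_le h2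
      rw [hk] at h1 ⊢
      rw [Nat.add_sub_cancel_left]
      linarith [mul_add t 2 k]

theorem quotientCost_spec {t : ℕ} (D : ℕ) :
    (D ≤ t ∧ t * quotientCost t D = 0) ∨ (t < D ∧ t * quotientCost t D + t ≤ 4 * D) := by
  by_cases h : D ≤ t
  · exact Or.inl ⟨h, by rw [quotientCost, if_pos h, mul_zero]⟩
  · refine Or.inr ⟨by omega, ?_⟩
    rw [quotientCost, if_neg h]
    have h1 := Nat.mul_div_le (4 * D) t
    rcases Nat.eq_zero_or_pos t with rfl | ht
    · simp
    · have h2 : 1 ≤ 4 * D / t := (Nat.le_div_iff_mul_le ht).2 (by omega)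
      obtain ⟨k, hk⟩ := Nat.exists_eq_add_of_le h2
      rw [hk] at h1 ⊢
      rw [Nat.add_sub_cancel_left]
      linarith [mul_add t 1 k]

theorem le_memberCost {t D e : ℕ} (ht : 1 ≤ t) (hD : t < D) (h : t * e + 2 * t ≤ 4 * D) :
    e ≤ memberCost t D := by
  rw [memberCost, if_neg (by omega)]
  refine Nat.le_sub_of_add_le ((Nat.le_div_iff_mul_le ht).2 ?_)
  linarith [add_mul e 2 t, mul_comm e t]

theorem le_quotientCost {t D e : ℕ} (ht : 1 ≤ t) (hD : t < D) (h : t * e + t ≤ 4 * D) :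
    e ≤ quotientCost t D := by
  rw [quotientCost, if_neg (by omega)]
  refine Nat.le_sub_of_add_le ((Nat.le_div_iff_mul_le ht).2 ?_)
  linarith [add_mul e 1 t, mul_comm e t]

/-- If at least two parts exceed `t`, their negative offsets pay for the expansion; if at most one
does, halving leaves enough slack. -/
theorem cost_step_member {t D u v w : ℕ} (ht : 1 ≤ t) (hD : t < D) (hsum : u + v + w ≤ D)
    (hu : 2 * u ≤ D) (hv : 2 * v ≤ D) (hw : 2 * w ≤ D) :
    1 + quotientCost t u + memberCost t w + memberCost t v ≤ memberCost t D := by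
  refine le_memberCost ht hD ?_
  rw [mul_add, mul_add, mul_add]
  rcases quotientCost_spec (t := t) u with ⟨h1, h1'⟩ | ⟨h1, h1'⟩ <;>
  rcases memberCost_spec (t := t) v with ⟨h2, h2'⟩ | ⟨h2, h2'⟩ <;>
  rcases memberCost_spec (t := t) w with ⟨h3, h3'⟩ | ⟨h3, h3'⟩ <;>
  omega

/-- Here `w` need not be halved. If it alone exceeds `t`, its offset 2 against the offset 1 of a
quotient pays exactly for the expansion. -/
theorem cost_step_quotient {t D u v w : ℕ} (ht : 1 ≤ t) (hD : t < D) (hsum : u + v + w ≤ D)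
    (hu : 2 * u ≤ D) (hv : 2 * v ≤ D) :
    1 + quotientCost t u + memberCost t w + quotientCost t v ≤ quotientCost t D := by
  refine le_quotientCost ht hD ?_
  rw [mul_add, mul_add, mul_add]
  rcases quotientCost_spec (t := t) u with ⟨h1, h1'⟩ | ⟨h1, h1'⟩ <;>
  rcases quotientCost_spec (t := t) v with ⟨h2, h2'⟩ | ⟨h2, h2'⟩ <;>
  rcases memberCost_spec (t := t) w with ⟨h3, h3'⟩ | ⟨h3, h3'⟩ <;>
  omega

variable {R σ I : Type*} [CommRing R]

/-- `p` arises from `e` expansions, each into a sum of `S` products of four factors, ending in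
factors of degree at most `t`. -/
def Expands (t S e : ℕ) (p : MvPolynomial σ R) : Prop :=
  IsSumOfProducts t (S ^ e) (1 + 3 * e) p

theorem Expands.of_totalDegree_le {t S : ℕ} (e : ℕ) (hS : 1 ≤ S) {p : MvPolynomial σ R}
    (h : p.totalDegree ≤ t) : Expands t S e p :=
  (IsSumOfProducts.of_totalDegree_le h).mono (Nat.one_le_pow _ _ hS) (by omega)

theorem Expands.mono {t S e e' : ℕ} (hS : 1 ≤ S) {p : MvPolynomial σ R} (h : Expands t S e p)
    (he : e ≤ e') : Expands t S e' p :=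
  IsSumOfProducts.mono h (Nat.pow_le_pow_right hS he) (by omega)

theorem Expands.term {t S e₁ e₂ e₃ : ℕ} {p q r : MvPolynomial σ R} (c : R)
    (hp : Expands t S e₁ p) (hq : Expands t S e₂ q) (hr : Expands t S e₃ r) :
    IsSumOfProducts t (S ^ (e₁ + e₂ + e₃)) (1 + 3 * (1 + (e₁ + e₂ + e₃))) (p * (C c * q) * r) := by
  have hc : IsSumOfProducts t 1 1 (C c : MvPolynomial σ R) :=
    IsSumOfProducts.of_totalDegree_le (by simp)
  refine ((IsSumOfProducts.mul hp (hc.mul hq)).mul hr).mono (le_of_eq ?_) (by omega)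
  rw [pow_add, pow_add, one_mul]

variable [Fintype I] [DecidableEq I] (P : ProductSystem R σ I)

/-- One expansion: the sum over triples supplies one factor of the power of `S`, and the scalar
counts as the fourth factor of each product. Vanishing summands need no degree information, so only
nonzero ones are constrained by `H`. -/
theorem expands_of_frontier {t m e : ℕ} {p : MvPolynomial σ R} {x : I → MvPolynomial σ R}
    (hS : 1 ≤ Fintype.card (I × I × I)) {i : I}
    (hp : p = ∑ z : I × I × I, if m < P.d z.1 ∧ P.d z.2.1 ≤ m then
      P.Q i z.1 * (C (P.coef z.1 z.2.1 z.2.2) * P.f z.2.2) * x z.2.1 else 0)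
    (H : ∀ a a' b, m < P.d a → P.d a' ≤ m → P.d a' + P.d b = P.d a → P.d b ≤ P.d a' →
      P.Q i a ≠ 0 → x a' ≠ 0 → ∃ e₁ e₂ e₃, 1 + e₁ + e₂ + e₃ ≤ e ∧
        Expands t (Fintype.card (I × I × I)) e₁ (P.Q i a) ∧
        Expands t (Fintype.card (I × I × I)) e₂ (P.f b) ∧
        Expands t (Fintype.card (I × I × I)) e₃ (x a')) (he : 1 ≤ e) :
    Expands t (Fintype.card (I × I × I)) e p := by
  obtain ⟨e, rfl⟩ := Nat.exists_eq_add_of_le he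
  rw [hp, Expands, pow_add, pow_one]
  refine IsSumOfProducts.sum _ _ ?_
  rintro ⟨a, a', b⟩ -
  dsimp only
  split_ifs with h
  · by_cases h0 : P.Q i a * (C (P.coef a a' b) * P.f b) * x a' = 0
    · rw [h0]
      exact IsSumOfProducts.zero
    have hc : P.coef a a' b ≠ 0 := by
      rintro hc
      simp [hc] at h0
    have hd := P.coef_ne_zero a a' b hc
    obtain ⟨e₁, e₂, e₃, hle, h1, h2, h3⟩ := H a a' b h.1 h.2 hd.1 hd.2
      (left_ne_zero_of_mul (left_ne_zero_of_mul h0)) (right_ne_zero_of_mul h0)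
    exact (Expands.term _ h1 h2 h3).mono (Nat.pow_le_pow_right hS (by omega)) (by omega)
  · exact IsSumOfProducts.zero

theorem f_eq_frontier {m : ℕ} (hm : 1 ≤ m) (i : I) (hi : m < P.d i) :
    P.f i = ∑ z : I × I × I, if m < P.d z.1 ∧ P.d z.2.1 ≤ m then
      P.Q i z.1 * (C (P.coef z.1 z.2.1 z.2.2) * P.f z.2.2) * P.f z.2.1 else 0 := by
  refine P.eq_sum_frontier m P.f (fun i hi => ?_) i hi
  rw [P.f_eq i (by omega)]
  simp only [T, Finset.sum_mul]

/-- Column `j` of `Q` solves `x = T x` except in row `j`, which lies below the threshold. -/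
theorem Q_eq_frontier {m : ℕ} (i j : I) (hj : P.d j ≤ m) (hi : m < P.d i) :
    P.Q i j = ∑ z : I × I × I, if m < P.d z.1 ∧ P.d z.2.1 ≤ m then
      P.Q i z.1 * (C (P.coef z.1 z.2.1 z.2.2) * P.f z.2.2) * P.Q z.2.1 j else 0 := by
  refine P.eq_sum_frontier m (fun a => P.Q a j) (fun i hi => ?_) i hi
  have h := congrFun (congrFun P.Q_eq i) j
  have hij : i ≠ j := by
    rintro rfl
    omega
  rwa [Matrix.add_apply, Matrix.one_apply_ne hij, add_zero, Matrix.mul_apply] at h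

/-- Members and quotients call each other, so one induction on the degree treats both. At each
degree members come first, since a quotient may expand into a member of its own degree. -/
theorem expands_aux {t : ℕ} (ht : 1 ≤ t) (hS : 1 ≤ Fintype.card (I × I × I)) (D : ℕ) :
    (∀ i, P.d i ≤ D → Expands t (Fintype.card (I × I × I)) (memberCost t (P.d i)) (P.f i)) ∧
    ∀ i j, P.d j ≤ P.d i → P.d i - P.d j ≤ D →
      Expands t (Fintype.card (I × I × I)) (quotientCost t (P.d i - P.d j)) (P.Q i j) := by
  induction D with
  | zero =>
    refine ⟨fun i hi => absurd (P.d_pos i) (by omega), fun i j hij hD => ?_⟩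
    by_cases h : P.Q i j = 0
    · rw [h]
      exact IsSumOfProducts.zero
    · have := P.degreeBounded_Q i j h
      exact Expands.of_totalDegree_le _ hS (by omega)
  | succ D ih =>
    have hf : ∀ i, P.d i ≤ D + 1 →
        Expands t (Fintype.card (I × I × I)) (memberCost t (P.d i)) (P.f i) := by
      intro i hi
      by_cases hit : P.d i ≤ t
      · exact Expands.of_totalDegree_le _ hS ((P.totalDegree_le i).trans hit)
      refine P.expands_of_frontier hS
        (P.f_eq_frontier (m := P.d i / 2) (by omega) i (by omega)) ?_ ?_
      · intro a a' b h1 h2 h3 h4 hQ _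
        have h5 := P.degreeBounded_Q i a hQ
        refine ⟨quotientCost t (P.d i - P.d a), memberCost t (P.d b), memberCost t (P.d a'),
          cost_step_member ht ?_ ?_ ?_ ?_ ?_, ih.2 i a ?_ ?_, ih.1 b ?_, ih.1 a' ?_⟩ <;> omega
      · exact le_memberCost ht (by omega) (by omega)
    refine ⟨hf, fun i j hij hD => ?_⟩
    by_cases hit : P.d i - P.d j ≤ t
    · by_cases h : P.Q i j = 0
      · rw [h]
        exact IsSumOfProducts.zero
      · have := P.degreeBounded_Q i j h
        exact Expands.of_totalDegree_le _ hS (by omega)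
    -- The midpoint between `d j` and `d i` halves both new quotients. The member `f b` may keep the
    -- full degree, which `hf` already covers.
    have hfr := P.Q_eq_frontier (m := P.d j + (P.d i - P.d j) / 2) i j (by omega) (by omega)
    refine P.expands_of_frontier (x := fun a => P.Q a j) hS hfr ?_ ?_
    · intro a a' b h1 h2 h3 h4 hQ hQ'
      have h5 := P.degreeBounded_Q i a hQ
      have h6 := P.degreeBounded_Q a' j hQ'
      refine ⟨quotientCost t (P.d i - P.d a), memberCost t (P.d b),
        quotientCost t (P.d a' - P.d j), cost_step_quotient ht ?_ ?_ ?_ ?_,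
        ih.2 i a ?_ ?_, hf b ?_, ih.2 a' j ?_ ?_⟩ <;> omega
    · exact le_quotientCost ht (by omega) (by omega)

/-- Every member is a sum of few products of few polynomials of degree at most `t`. -/
theorem isSumOfProducts {t : ℕ} (ht : 1 ≤ t) (i : I) :
    IsSumOfProducts t ((Fintype.card I ^ 3) ^ (4 * P.d i / t)) (1 + 3 * (4 * P.d i / t))
      (P.f i) := by
  have hI : 1 ≤ Fintype.card I := Fintype.card_pos_iff.2 ⟨i⟩
  have hcard : Fintype.card (I × I × I) = Fintype.card I ^ 3 := by
    rw [Fintype.card_prod, Fintype.card_prod]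
    ring
  have hS : 1 ≤ Fintype.card (I × I × I) := hcard ▸ Nat.one_le_pow _ _ hI
  have h := ((P.expands_aux ht hS (P.d i)).1 i le_rfl).mono hS (e' := 4 * P.d i / t) (by
    rw [memberCost]
    split_ifs
    exacts [Nat.zero_le _, Nat.sub_le _ _])
  rwa [Expands, hcard] at h

end ProductSystem

/-! ### From circuits to product systems -/

section ProductSpan

variable {R σ ι : Type*} [CommRing R] (G : ι → MvPolynomial σ R)

/-- The span of the products of two positive-degree homogeneous components of members of `G`, of
total degree `e`. -/
noncomputable def productSpan (e : ℕ) : Submodule R (MvPolynomial σ R) :=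
  Submodule.span R {q | ∃ i j a b, 1 ≤ a ∧ 1 ≤ b ∧ a + b = e ∧
    q = homogeneousComponent a (G i) * homogeneousComponent b (G j)}

/-- All the homogeneous components of `g` of degree at least `2` lie in the product spans. -/
def IsGenerated (g : MvPolynomial σ R) : Prop :=
  ∀ e, 2 ≤ e → homogeneousComponent e g ∈ productSpan G e

variable {G}

theorem IsGenerated.of_totalDegree_le {g : MvPolynomial σ R} (h : g.totalDegree ≤ 1) :
    IsGenerated G g := fun e he => by
  rw [homogeneousComponent_eq_zero _ _ (by omega)]
  exact zero_mem _

theorem IsGenerated.sum {κ : Type*} {s : Finset κ} {g : κ → MvPolynomial σ R}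
    (h : ∀ k ∈ s, IsGenerated G (g k)) : IsGenerated G (∑ k ∈ s, g k) := fun e he => by
  rw [map_sum]
  exact Submodule.sum_mem _ fun k hk => h k hk e he

/-- In the convolution of components, a factor of degree 0 is a scalar and the other factor is
already generated; the remaining terms are generators. -/
theorem IsGenerated.mul {g h : MvPolynomial σ R} (hg : IsGenerated G g) (hh : IsGenerated G h)
    (hg' : g ∈ Set.range G) (hh' : h ∈ Set.range G) : IsGenerated G (g * h) := fun e he => by
  rw [homogeneousComponent_mul]
  refine Submodule.sum_mem _ ?_
  rintro ⟨a, b⟩ hab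
  have hab' : a + b = e := Finset.HasAntidiagonal.mem_antidiagonal.1 hab
  dsimp only
  rcases Nat.eq_zero_or_pos a with rfl | ha
  · obtain rfl : b = e := by omega
    rw [homogeneousComponent_zero, ← smul_eq_C_mul]
    exact Submodule.smul_mem _ _ (hh b he)
  rcases Nat.eq_zero_or_pos b with rfl | hb
  · obtain rfl : a = e := by omega
    rw [homogeneousComponent_zero, mul_comm, ← smul_eq_C_mul]
    exact Submodule.smul_mem _ _ (hg a he)
  obtain ⟨i, rfl⟩ := hg'
  obtain ⟨j, rfl⟩ := hh'
  exact Submodule.subset_span ⟨i, j, a, b, ha, hb, hab', rfl⟩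

end ProductSpan

namespace ArithCircuit

variable {R σ : Type*} [CommRing R] (C : ArithCircuit R σ)

/-- The product of the polynomials computed by the first `k` arguments of `v`. -/
noncomputable def partialProd (v : C.Gate) (k : ℕ) : MvPolynomial σ R :=
  (((C.args v).toList.take k).map C.gatePoly).prod

/-- The polynomials computed by the gates, and the partial products at the gates. -/
noncomputable def polys : C.Gate ⊕ C.Gate × Fin (C.size + 1) → MvPolynomial σ R
  | .inl v => C.gatePoly v
  | .inr x => C.partialProd x.1 x.2

/-- Partial products turn multiplication of unbounded fan-in into binary multiplication, at
quadratic cost in the number of polynomials. -/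
theorem isGenerated_partialProd (v : C.Gate)
    (h : ∀ u ∈ C.args v, IsGenerated C.polys (C.gatePoly u)) (k : ℕ) (hk : k ≤ C.size) :
    IsGenerated C.polys (C.partialProd v k) := by
  induction k with
  | zero => exact IsGenerated.of_totalDegree_le (by simp [partialProd])
  | succ k ih =>
    by_cases hlt : k < (C.args v).toList.length
    · have heq : C.partialProd v (k + 1) =
          C.partialProd v k * C.gatePoly (C.args v).toList[k] := by
        rw [partialProd, List.take_succ_eq_append_getElem hlt, List.map_append, List.prod_append,
          List.map_singleton, List.prod_singleton, partialProd]
      rw [heq]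
      refine (ih (by omega)).mul (h _ ?_) ⟨.inr (v, ⟨k, by omega⟩), rfl⟩ ⟨.inl _, rfl⟩
      exact Finset.mem_toList.1 (List.getElem_mem hlt)
    · have heq : C.partialProd v (k + 1) = C.partialProd v k := by
        rw [partialProd, partialProd, List.take_of_length_le (by omega),
          List.take_of_length_le (by omega)]
      rw [heq]
      exact ih (by omega)

theorem isGenerated_gatePoly (v : C.Gate) : IsGenerated C.polys (C.gatePoly v) := by
  induction v using C.acyclic.induction with
  | _ v ih =>
    rw [gatePoly_eq]
    cases C.label v with
    | const c => exact IsGenerated.of_totalDegree_le (by simp)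
    | var i =>
      refine IsGenerated.of_totalDegree_le ?_
      exact (isHomogeneous_X R i).totalDegree_le
    | add => exact IsGenerated.sum ih
    | mul =>
      have heq : ∏ u ∈ C.args v, C.gatePoly u = C.partialProd v C.size := by
        rw [partialProd, List.take_of_length_le, Finset.prod_map_toList]
        rw [Finset.length_toList]
        exact Finset.card_le_univ _
      dsimp only
      rw [heq]
      exact C.isGenerated_partialProd v ih _ le_rfl

theorem isGenerated_polys (i) : IsGenerated C.polys (C.polys i) := by
  rcases i with v | ⟨v, k⟩
  · exact C.isGenerated_gatePoly v
  · exact C.isGenerated_partialProd v (fun u _ => C.isGenerated_gatePoly u) k (by omega)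

/-- Depth reduction for a homogeneous polynomial computed by a circuit. -/
theorem Computes.isSumOfProducts {C : ArithCircuit R σ} {p : MvPolynomial σ R} {n t : ℕ}
    (hC : C.Computes p) (hp : p.IsHomogeneous n) (hn : 1 ≤ n) (ht : 1 ≤ t) :
    IsSumOfProducts t (((C.size * (C.size + 2) * n) ^ 3) ^ (4 * n / t)) (1 + 3 * (4 * n / t))
      p := by
  classical
  obtain ⟨P, hf, hd⟩ := ProductSystem.exists_of_mem_span
    (I := (C.Gate ⊕ C.Gate × Fin (C.size + 1)) × Fin n)
    (fun i => homogeneousComponent (i.2 + 1) (C.polys i.1)) (fun i => i.2 + 1)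
    (fun i => by omega) (fun i => totalDegree_homogeneousComponent_le _ _) (fun i hi => by
      refine Submodule.span_mono ?_ (C.isGenerated_polys i.1 _ hi)
      rintro _ ⟨j, k, a, b, ha, hb, hab, rfl⟩
      have := i.2.2
      refine ⟨(j, ⟨a - 1, by omega⟩), (k, ⟨b - 1, by omega⟩), ?_, ?_⟩
      · dsimp only
        omega
      · dsimp only
        rw [Nat.sub_add_cancel ha, Nat.sub_add_cancel hb])
  have hcard : Fintype.card ((C.Gate ⊕ C.Gate × Fin (C.size + 1)) × Fin n) =
      C.size * (C.size + 2) * n := by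
    rw [Fintype.card_prod, Fintype.card_sum, Fintype.card_prod, Fintype.card_fin, Fintype.card_fin,
      ← size]
    ring
  have h := P.isSumOfProducts ht (.inl C.out, ⟨n - 1, by omega⟩)
  rw [hf, hd, hcard] at h
  dsimp only at h
  rw [Nat.sub_add_cancel hn] at h
  have heq : homogeneousComponent n (C.polys (.inl C.out)) = p := by
    rw [polys, show C.gatePoly C.out = p from hC]
    exact homogeneousComponent_eq_self hp
  rwa [heq] at h

end ArithCircuit

theorem isHomogeneous_genericPermanent (R : Type*) [CommRing R] (n : ℕ) :
    (genericPermanent R n).IsHomogeneous n := by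
  rw [genericPermanent, Matrix.permanent]
  refine IsHomogeneous.sum _ _ _ fun π _ => ?_
  have h := IsHomogeneous.prod Finset.univ
    (fun i => Matrix.mvPolynomialX (Fin n) (Fin n) R (π i) i) (fun _ => 1)
    (fun i _ => isHomogeneous_X R (π i, i))
  simpa using h

/-! ### Padding to uniform shape -/

section Padding

variable {R σ : Type*} [CommRing R]

theorem List.prod_fin_getD {α : Type*} [CommMonoid α] (l : List α) {k : ℕ} (h : l.length ≤ k) :
    ∏ j : Fin k, l.getD j 1 = l.prod := by
  rw [Fin.prod_univ_eq_prod_range (fun j => l.getD j 1)]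
  induction l generalizing k with
  | nil => simp
  | cons a l ih =>
    obtain ⟨k, rfl⟩ := Nat.exists_eq_succ_of_ne_zero (n := k) (by
      rintro rfl
      simp at h)
    rw [Finset.prod_range_succ', List.prod_cons, ← ih (k := k) (by simpa using h), mul_comm]
    simp

theorem List.sum_fin_getD {α : Type*} [AddCommMonoid α] (l : List α) {k : ℕ} (h : l.length ≤ k) :
    ∑ j : Fin k, l.getD j 0 = l.sum :=
  List.prod_fin_getD (α := Multiplicative α) l h

theorem IsSumOfProducts.exists_fin {t M k : ℕ} {p : MvPolynomial σ R}
    (h : IsSumOfProducts t M k p) (hk : 1 ≤ k) :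
    ∃ g : Fin M → Fin k → MvPolynomial σ R,
      (∀ i j, (g i j).totalDegree ≤ t) ∧ ∑ i, ∏ j, g i j = p := by
  obtain ⟨L, hM, hL, rfl⟩ := h
  -- Short products are padded by 1 and missing products are filled with 0; the latter vanish only
  -- if they have at least one factor.
  have hk0 : k ≠ 0 := by omega
  refine ⟨fun i j => if h : i < L.length then L[(i : ℕ)].getD j 1 else 0, fun i j => ?_, ?_⟩
  · dsimp only
    split_ifs with h
    · by_cases hj : j < (L[(i : ℕ)]).length
      · rw [List.getD_eq_getElem _ _ hj]
        exact (hL _ (List.getElem_mem h)).2 _ (List.getElem_mem hj)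
      · rw [List.getD_eq_default _ _ (by omega)]
        simp
    · simp
  · rw [← List.sum_fin_getD (L.map List.prod) (k := M) (by simpa using hM)]
    refine Finset.sum_congr rfl fun i _ => ?_
    by_cases h : i < L.length
    · simp only [h, dif_pos]
      rw [List.prod_fin_getD _ (hL _ (List.getElem_mem h)).1,
        List.getD_eq_getElem _ _ (by simpa using h), List.getElem_map]
    · simp only [h, dif_neg, not_false_eq_true]
      rw [List.getD_eq_default _ _ (by simpa using h)]
      simp [hk0]

end Padding

/-- A polynomial of total degree at most `t` as a sum over all words of length `t` in the variables
and `1`. -/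
theorem exists_sum_words {R σ : Type*} [CommRing R] [Fintype σ] {t : ℕ} {q : MvPolynomial σ R}
    (hq : q.totalDegree ≤ t) :
    ∃ c : (Fin t → Option σ) → R, ∑ φ, C (c φ) * ∏ j, (φ j).elim 1 X = q := by
  classical
  have h : q ∈ Submodule.span R (Set.range fun φ : Fin t → Option σ =>
      ∏ j, (φ j).elim (1 : MvPolynomial σ R) X) := by
    rw [← support_sum_monomial_coeff q]
    refine Submodule.sum_mem _ fun m hm => ?_
    rw [← mul_one (coeff m q), ← smul_eq_mul, ← smul_monomial]
    refine Submodule.smul_mem _ _ (Submodule.subset_span ?_)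
    set l := (Finsupp.toMultiset m).toList with hl
    have hlen : l.length ≤ t := by
      rw [hl, Multiset.length_toList, Finsupp.card_toMultiset]
      exact (le_totalDegree hm).trans hq
    refine ⟨fun j => l[(j : ℕ)]?, ?_⟩
    have h1 : ∀ j : Fin t, (l[(j : ℕ)]?).elim (1 : MvPolynomial σ R) X =
        (l.map X).getD j 1 := by
      intro j
      rw [List.getD_eq_getElem?_getD, List.getElem?_map]
      cases l[(j : ℕ)]? <;> rfl
    simp only [h1]
    rw [List.prod_fin_getD _ (by simpa using hlen), ← Multiset.prod_coe, ← Multiset.map_coe, hl,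
      Multiset.coe_toList, Finsupp.toMultiset_map, Finsupp.prod_toMultiset, monomial_eq, C_1,
      one_mul, Finsupp.prod_mapDomain_index (by simp) (by simp [pow_add])]
  obtain ⟨c, hc⟩ := (Submodule.mem_span_range_iff_exists_fun R).1 h
  exact ⟨c, by simpa only [smul_eq_C_mul] using hc⟩

/-! ### Tree-shaped circuits of depth four -/

/-- The gates of a tree of depth four in which the children of the gates of a level are indexed by
`A`, `B`, `Φ` and `D` respectively. -/
inductive TreeGate (A B Φ D : Type)
  | out
  | prod (a : A)
  | sum (a : A) (b : B)
  | mon (a : A) (b : B) (φ : Φ)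
  | leaf (a : A) (b : B) (φ : Φ) (d : D)

namespace TreeGate

variable {A B Φ D : Type}

/-- The tree gates as a sum of types. -/
def equivSum : TreeGate A B Φ D ≃ Unit ⊕ A ⊕ (A × B) ⊕ (A × B × Φ) ⊕ (A × B × Φ × D) where
  toFun
    | out => .inl ()
    | prod a => .inr (.inl a)
    | sum a b => .inr (.inr (.inl (a, b)))
    | mon a b φ => .inr (.inr (.inr (.inl (a, b, φ))))
    | leaf a b φ d => .inr (.inr (.inr (.inr (a, b, φ, d))))
  invFun
    | .inl () => out
    | .inr (.inl a) => prod a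
    | .inr (.inr (.inl (a, b))) => sum a b
    | .inr (.inr (.inr (.inl (a, b, φ)))) => mon a b φ
    | .inr (.inr (.inr (.inr (a, b, φ, d)))) => leaf a b φ d
  left_inv x := by cases x <;> rfl
  right_inv x := by rcases x with _ | _ | _ | _ | _ <;> rfl

variable [Fintype A] [Fintype B] [Fintype Φ] [Fintype D]

instance : Fintype (TreeGate A B Φ D) := Fintype.ofEquiv _ equivSum.symm

theorem card_eq : Fintype.card (TreeGate A B Φ D) =
    1 + (Fintype.card A + (Fintype.card A * Fintype.card B +
      (Fintype.card A * (Fintype.card B * Fintype.card Φ) +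
        Fintype.card A * (Fintype.card B * (Fintype.card Φ * Fintype.card D))))) := by
  rw [Fintype.card_congr equivSum]
  simp only [Fintype.card_sum, Fintype.card_prod, Fintype.card_unit]

/-- The level of a gate. -/
def level : TreeGate A B Φ D → ℕ
  | out => 4
  | prod _ => 3
  | sum _ _ => 2
  | mon _ _ _ => 1
  | leaf _ _ _ _ => 0

/-- The children of a gate. -/
def children : TreeGate A B Φ D → Finset (TreeGate A B Φ D)
  | out => Finset.univ.map ⟨prod, fun _ _ h => by cases h; rfl⟩
  | prod a => Finset.univ.map ⟨sum a, fun _ _ h => by cases h; rfl⟩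
  | sum a b => Finset.univ.map ⟨mon a b, fun _ _ h => by cases h; rfl⟩
  | mon a b φ => Finset.univ.map ⟨leaf a b φ, fun _ _ h => by cases h; rfl⟩
  | leaf _ _ _ _ => ∅

theorem level_of_mem_children {u v : TreeGate A B Φ D} (h : u ∈ v.children) :
    v.level = u.level + 1 := by
  cases v <;> simp only [children, Finset.mem_map, Finset.mem_univ, true_and,
    Finset.notMem_empty] at h
  all_goals
    obtain ⟨_, rfl⟩ := h
    rfl

end TreeGate

namespace ArithCircuit

open TreeGate

variable {R σ : Type*} {A B Φ D : Type} [Fintype A] [Fintype B] [Fintype Φ] [Fintype D]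
  [Nonempty A] [Nonempty B] [Nonempty Φ] [Nonempty D]

/-- The tree-shaped circuit of depth four with the given labels at its leaves. -/
def tree (ℓ : A → B → Φ → D → R ⊕ σ) : ArithCircuit R σ where
  Gate := TreeGate A B Φ D
  label
    | .out => .add
    | .prod _ => .mul
    | .sum _ _ => .add
    | .mon _ _ _ => .mul
    | .leaf a b φ d => Sum.elim .const .var (ℓ a b φ d)
  args := children
  acyclic := Subrelation.wf (r := fun u v => level u < level v)
    (fun h => (Nat.lt_succ_self _).trans_eq (level_of_mem_children h).symm) (measure level).wf
  args_eq_empty_iff v := by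
    cases v with
    | leaf a b φ d =>
      simp only [children, true_iff]
      rcases ℓ a b φ d with c | i <;> trivial
    | _ => simp [children, GateLabel.IsInput, Finset.univ_eq_empty_iff]
  out := .out
  out_iff v := by
    constructor
    · intro h
      cases v with
      | out => rfl
      | prod a => exact (h .out (Finset.mem_map_of_mem _ (Finset.mem_univ a))).elim
      | sum a b => exact (h (.prod a) (Finset.mem_map_of_mem _ (Finset.mem_univ b))).elim
      | mon a b φ => exact (h (.sum a b) (Finset.mem_map_of_mem _ (Finset.mem_univ φ))).elim
      | leaf a b φ d => exact (h (.mon a b φ) (Finset.mem_map_of_mem _ (Finset.mem_univ d))).elim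
    · rintro rfl w hw
      have := level_of_mem_children hw
      cases w <;> simp [level] at this

variable (ℓ : A → B → Φ → D → R ⊕ σ)

theorem gatePoly_tree_out [CommRing R] : (tree ℓ).gatePoly TreeGate.out =
    ∑ a, ∏ b, ∑ φ, ∏ d, Sum.elim MvPolynomial.C X (ℓ a b φ d) := by
  have hleaf : ∀ a b φ d, (tree ℓ).gatePoly (TreeGate.leaf a b φ d) =
      Sum.elim MvPolynomial.C X (ℓ a b φ d) := by
    intro a b φ d
    refine (gatePoly_eq _ _).trans ?_
    simp only [tree]
    rcases ℓ a b φ d with c | i <;> rfl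
  have hmon : ∀ a b φ, (tree ℓ).gatePoly (TreeGate.mon a b φ) =
      ∏ d, Sum.elim MvPolynomial.C X (ℓ a b φ d) := by
    intro a b φ
    refine (gatePoly_eq _ _).trans ?_
    exact (Finset.prod_map _ _ _).trans (Finset.prod_congr rfl fun d _ => hleaf a b φ d)
  have hsum : ∀ a b, (tree ℓ).gatePoly (TreeGate.sum a b) =
      ∑ φ, ∏ d, Sum.elim MvPolynomial.C X (ℓ a b φ d) := by
    intro a b
    refine (gatePoly_eq _ _).trans ?_
    exact (Finset.sum_map _ _ _).trans (Finset.sum_congr rfl fun φ _ => hmon a b φ)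
  have hprod : ∀ a, (tree ℓ).gatePoly (TreeGate.prod a) =
      ∏ b, ∑ φ, ∏ d, Sum.elim MvPolynomial.C X (ℓ a b φ d) := by
    intro a
    refine (gatePoly_eq _ _).trans ?_
    exact (Finset.prod_map _ _ _).trans (Finset.prod_congr rfl fun b _ => hsum a b)
  refine (gatePoly_eq _ _).trans ?_
  exact (Finset.sum_map _ _ _).trans (Finset.sum_congr rfl fun a _ => hprod a)

theorem isSigmaPiSigmaPi_tree {α β : ℝ} (hα : (Fintype.card B : ℝ) ≤ α)
    (hβ : (Fintype.card D : ℝ) ≤ β) : (tree ℓ).IsSigmaPiSigmaPi α β := by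
  refine ⟨TreeGate.level, rfl, fun v u h => level_of_mem_children h, fun v => ?_, fun v => ?_,
    fun v => ?_, fun v hv => ?_, fun v hv => ?_⟩
  · cases v with
    | leaf a b φ d =>
      simp only [tree, TreeGate.level, iff_true]
      rcases ℓ a b φ d with c | i <;> trivial
    | _ => simp [tree, TreeGate.level, GateLabel.IsInput]
  · cases v with
    | leaf a b φ d =>
      simp only [tree, TreeGate.level]
      rcases ℓ a b φ d with c | i <;> simp
    | _ => simp [tree, TreeGate.level]
  · cases v with
    | leaf a b φ d =>
      simp only [tree, TreeGate.level]
      rcases ℓ a b φ d with c | i <;> simp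
    | _ => simp [tree, TreeGate.level]
  · cases v <;> simp only [TreeGate.level] at hv <;> try omega
    exact (congrArg Nat.cast ((Finset.card_map _).trans Finset.card_univ)).trans_le hα
  · cases v <;> simp only [TreeGate.level] at hv <;> try omega
    exact (congrArg Nat.cast ((Finset.card_map _).trans Finset.card_univ)).trans_le hβ

/-- A sum of products of polynomials of small degree is computed by a circuit of depth four. -/
theorem exists_isSigmaPiSigmaPi [CommRing R] {V : Type} [Fintype V] {t M k : ℕ}
    {p : MvPolynomial V R} (h : IsSumOfProducts t M k p) (hM : 1 ≤ M) (hk : 1 ≤ k) :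
    ∃ C : ArithCircuit R V, C.Computes p ∧ C.IsSigmaPiSigmaPi k (t + 1) ∧
      C.size ≤ 5 * (M * k * (Fintype.card V + 1) ^ t * (t + 1)) := by
  classical
  obtain ⟨g, hg, rfl⟩ := h.exists_fin hk
  choose c hc using fun i j => exists_sum_words (hg i j)
  have : NeZero M := ⟨by omega⟩
  have : NeZero k := ⟨by omega⟩
  -- The extra leaf `none` carries the coefficient of the word, hence fan-in `t + 1` at level 1.
  refine ⟨tree (A := Fin M) (B := Fin k) (Φ := Fin t → Option V) (D := Option (Fin t))
    fun i j φ d => d.elim (.inl (c i j φ)) fun x => (φ x).elim (.inl 1) .inr, ?_, ?_, ?_⟩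
  · refine (gatePoly_tree_out _).trans (Finset.sum_congr rfl fun i _ =>
      Finset.prod_congr rfl fun j _ => ?_)
    rw [← hc i j]
    refine Finset.sum_congr rfl fun φ _ => ?_
    rw [Fintype.prod_option]
    refine congrArg₂ (· * ·) rfl (Finset.prod_congr rfl fun x _ => ?_)
    cases hφ : φ x <;> simp [hφ]
  · exact isSigmaPiSigmaPi_tree _ (by simp) (by simp)
  · refine (le_of_eq TreeGate.card_eq).trans ?_
    simp only [Fintype.card_fin, Fintype.card_option, Fintype.card_pi, Finset.prod_const,
      Finset.card_univ]
    have hΦ : 1 ≤ (Fintype.card V + 1) ^ t := Nat.one_le_pow _ _ (by omega)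
    generalize (Fintype.card V + 1) ^ t = Φ at *
    have h1 : M ≤ M * k := Nat.le_mul_of_pos_right _ hk
    have h2 : M * k ≤ M * k * Φ := Nat.le_mul_of_pos_right _ hΦ
    have h3 : M * k * Φ ≤ M * k * Φ * (t + 1) := Nat.le_mul_of_pos_right _ (by omega)
    rw [← mul_assoc M k, ← mul_assoc k, ← mul_assoc M, ← mul_assoc M k]
    omega

end ArithCircuit

/-! ### Size estimates and conclusion -/

theorem Polynomial.exists_eval_le_pow (p : Polynomial ℕ) :
    ∃ c : ℕ, ∀ n : ℕ, 2 ≤ n → p.eval n ≤ n ^ c := by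
  induction p using Polynomial.induction_on' with
  | add p q hp hq =>
    obtain ⟨a, ha⟩ := hp
    obtain ⟨b, hb⟩ := hq
    refine ⟨a + b + 1, fun n hn => ?_⟩
    rw [Polynomial.eval_add]
    have h1 : n ^ a ≤ n ^ (a + b) := Nat.pow_le_pow_right (by omega) (by omega)
    have h2 : n ^ b ≤ n ^ (a + b) := Nat.pow_le_pow_right (by omega) (by omega)
    calc p.eval n + q.eval n ≤ n ^ (a + b) * 2 := by linarith [ha n hn, hb n hn]
      _ ≤ n ^ (a + b) * n := Nat.mul_le_mul_left _ hn
      _ = n ^ (a + b + 1) := (pow_succ _ _).symm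
  | monomial k a =>
    refine ⟨a + k, fun n hn => ?_⟩
    rw [Polynomial.eval_monomial, pow_add]
    exact Nat.mul_le_mul_right _
      ((Nat.lt_two_pow_self).le.trans (Nat.pow_le_pow_left hn a))

theorem depthFour_size_le {n s c t : ℕ} (hn : 2 ≤ n) (hs : s + 2 ≤ n ^ c) (ht : 1 ≤ t)
    (htn : t ≤ n) (hdiv : 4 * n / t ≤ 12 * t) :
    5 * (((s * (s + 2) * n) ^ 3) ^ (4 * n / t) * (1 + 3 * (4 * n / t)) *
      (Fintype.card (Fin n × Fin n) + 1) ^ t * (t + 1)) ≤ n ^ ((72 * c + 51) * t) := by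
  have hn1 : 1 ≤ n := by omega
  have hN : s * (s + 2) * n ≤ n ^ (2 * c + 1) := by
    rw [pow_succ, two_mul, pow_add]
    exact Nat.mul_le_mul_right _ (Nat.mul_le_mul (by omega) hs)
  have hM : ((s * (s + 2) * n) ^ 3) ^ (4 * n / t) ≤ n ^ ((2 * c + 1) * 3 * (12 * t)) := by
    rw [pow_mul, pow_mul n]
    exact (Nat.pow_le_pow_left (Nat.pow_le_pow_left hN 3) _).trans
      (Nat.pow_le_pow_right (Nat.one_le_pow _ _ (Nat.one_le_pow _ _ hn1)) hdiv)
  have h8 : 2 ^ 6 ≤ n ^ 6 := Nat.pow_le_pow_left hn 6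
  have hk : 1 + 3 * (4 * n / t) ≤ n ^ 7 := by
    rw [pow_succ n 6]
    have : 64 * n ≤ n ^ 6 * n := Nat.mul_le_mul_right n h8
    omega
  have hcard : Fintype.card (Fin n × Fin n) + 1 ≤ n ^ 3 := by
    rw [Fintype.card_prod, Fintype.card_fin]
    nlinarith [Nat.mul_le_mul hn hn, Nat.mul_le_mul_right (n * n) hn]
  have hΦ : (Fintype.card (Fin n × Fin n) + 1) ^ t ≤ n ^ (3 * t) := by
    rw [pow_mul]
    exact Nat.pow_le_pow_left hcard t
  have ht1 : t + 1 ≤ n ^ 2 := by nlinarith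
  have h5 : 5 ≤ n ^ 3 := (by norm_num : 5 ≤ 2 ^ 3).trans (Nat.pow_le_pow_left hn 3)
  calc _ ≤ n ^ 3 * (n ^ ((2 * c + 1) * 3 * (12 * t)) * n ^ 7 * n ^ (3 * t) * n ^ 2) := by gcongr
    _ = n ^ ((72 * c + 36) * t + 3 * t + 12) := by
      simp only [← pow_add]
      congr 1
      ring
    _ ≤ n ^ ((72 * c + 51) * t) := Nat.pow_le_pow_right hn1 (by linarith)

theorem theorem2 (p : Polynomial ℕ) :
    ∃ K : ℝ, 0 < K ∧ ∀ (R : Type*) [CommRing R] (n : ℕ), 2 ≤ n →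
      (∃ C : ArithCircuit R (Fin n × Fin n),
        C.Computes (genericPermanent R n) ∧ C.size ≤ p.eval n) →
      ∃ C : ArithCircuit R (Fin n × Fin n),
        C.Computes (genericPermanent R n) ∧
        C.IsSigmaPiSigmaPi (K * √(n : ℝ)) (K * √(n : ℝ)) ∧
        (C.size : ℝ) ≤ (2 : ℝ) ^ (K * √(n : ℝ) * Real.log n) := by
  -- The summand 2 lets a single power of `n` bound the factor `C.size + 2` in the number of
  -- members.
  obtain ⟨c, hc⟩ := (p + 2).exists_eval_le_pow
  refine ⟨2 * (72 * c + 51), by positivity, ?_⟩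
  rintro R _ n hn ⟨C, hC, hsize⟩
  have hs : C.size + 2 ≤ n ^ c := by
    have h := hc n hn
    rw [Polynomial.eval_add, Polynomial.eval_ofNat] at h
    omega
  set t := n.sqrt with ht_def
  have ht : 1 ≤ t := Nat.le_sqrt.2 (by omega)
  have htn : t ≤ n := Nat.sqrt_le_self n
  -- From `n ≤ t² + 2t ≤ 3t²`.
  have hdiv : 4 * n / t ≤ 12 * t := by
    refine Nat.div_le_of_le_mul ?_
    have := Nat.sqrt_le_add n
    nlinarith [Nat.mul_le_mul_right t ht]
  have hpos : 1 ≤ C.size := Fintype.card_pos_iff.2 ⟨C.out⟩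
  obtain ⟨C', h1, ⟨level, h2, h3, h4, h5, h6, h7, h8⟩, h9⟩ :=
    ArithCircuit.exists_isSigmaPiSigmaPi
      (hC.isSumOfProducts (isHomogeneous_genericPermanent R n) (by omega) ht)
      (Nat.one_le_pow _ _ (Nat.one_le_pow _ _ (by positivity))) (by omega)
  have htR : (t : ℝ) ≤ √(n : ℝ) := Real.nat_sqrt_le_real_sqrt
  have ht1 : (1 : ℝ) ≤ t := by exact_mod_cast ht
  have hc0 : (0 : ℝ) ≤ c := Nat.cast_nonneg c
  have hK : ((72 * c + 51 : ℕ) : ℝ) * t ≤ (72 * c + 51) * √(n : ℝ) := by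
    push_cast
    gcongr
  have hcs : 0 ≤ (c : ℝ) * √(n : ℝ) := by positivity
  refine ⟨C', h1, ⟨level, h2, h3, h4, h5, h6, fun v hv => (h7 v hv).trans ?_,
    fun v hv => (h8 v hv).trans (by linarith)⟩, ?_⟩
  · have : ((1 + 3 * (4 * n / t) : ℕ) : ℝ) ≤ ((1 + 3 * (12 * t) : ℕ) : ℝ) := by
      exact_mod_cast Nat.add_le_add_left (Nat.mul_le_mul_left 3 hdiv) 1
    push_cast at this ⊢
    linarith
  · have hle := h9.trans (depthFour_size_le hn hs ht htn hdiv)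
    have hn0 : (0 : ℝ) < n := by positivity
    have hlog : 0 ≤ Real.log n := Real.log_natCast_nonneg n
    calc (C'.size : ℝ) ≤ (n : ℝ) ^ ((72 * c + 51) * t) := by exact_mod_cast hle
      _ = Real.exp (Real.log n * (((72 * c + 51 : ℕ) : ℝ) * t)) := by
        rw [← Real.rpow_def_of_pos hn0, ← Nat.cast_mul, Real.rpow_natCast]
      _ ≤ Real.exp (Real.log 2 * (2 * (72 * c + 51) * √(n : ℝ) * Real.log n)) := by
        refine Real.exp_le_exp.2 ?_
        -- The logarithm is natural and the base is 2; the factor 2 in `K` absorbs `1 / log 2`.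
        have h2 : (1 : ℝ) ≤ Real.log 2 * 2 := by linarith [Real.log_two_gt_d9]
        calc _ ≤ Real.log n * ((72 * c + 51) * √(n : ℝ)) := by gcongr
          _ ≤ Real.log 2 * 2 * (Real.log n * ((72 * c + 51) * √(n : ℝ))) :=
            le_mul_of_one_le_left (by positivity) h2
          _ = _ := by ring
      _ = _ := (Real.rpow_def_of_pos two_pos _).symm
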